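/- Let $\mathscr A$ be a (complex, not necessarily unital) $C^*$-algebra and let $\mathscr E=l_2(\mathscr A)$ be the standard Hilbert $\mathscr A$-module of all sequences $(a_i)$ in $\mathscr A$ for which $\sum_i a_i^*a_i$ converges in norm, with $\langle (a_i),(b_i)\rangle=\sum_i a_i^*b_i$. Let $\mathcal L(\mathscr E)$ be the set of adjointable operators on $\mathscr E$, ordered by $S\le T$ if and only if $\langle Sx,x\rangle\le\langle Tx,x\rangle$ in $\mathscr A$ for all $x\in\mathscr E$. Let $A,B\in\mathcal L(\mathscr E)$ and let $\lambda$ be a real number. If $BB^*\le\lambda AA^*$, then for every pure state $f$ on $\mathscr A$ $$\mathscr R(B)\subseteq\mathscr R(A)+\mathscr N_{\mathscr E,f},\qquad \mathscr N_{\mathscr E,f}=\{x\in\mathscr E: f(\langle x,x\rangle)=0\},$$ where $\mathscr R(T)$ denotes the range of $T$. -/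

import Mathlib

open scoped ComplexOrder Pointwise

noncomputable section

section Summability

variable {𝒜 : Type*} [NonUnitalCStarAlgebra 𝒜] [PartialOrder 𝒜] [StarOrderedRing 𝒜]

/-- Comparison test for series of positive elements of a C⋆-algebra. -/
theorem summable_of_nonneg_of_le_cstar {a b : ℕ → 𝒜} (h0 : ∀ i, 0 ≤ a i) (hab : ∀ i, a i ≤ b i)
    (hb : Summable b) : Summable a := by
  rw [summable_iff_vanishing_norm] at hb ⊢
  intro ε hε
  obtain ⟨s, hs⟩ := hb ε hε
  refine ⟨s, fun t ht => lt_of_le_of_lt ?_ (hs t ht)⟩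
  exact CStarAlgebra.norm_le_norm_of_nonneg_of_le (Finset.sum_nonneg fun i _ => h0 i)
    (Finset.sum_le_sum fun i _ => hab i)

theorem star_mul_self_add_le (a b : 𝒜) :
    star (a + b) * (a + b) ≤ (2 : ℂ) • (star a * a) + (2 : ℂ) • (star b * b) := by
  have h := star_mul_self_nonneg (a - b)
  have e : (2 : ℂ) • (star a * a) + (2 : ℂ) • (star b * b) - star (a + b) * (a + b)
      = star (a - b) * (a - b) := by
    simp only [two_smul, star_add, star_sub, add_mul, mul_add, sub_mul, mul_sub]
    abel
  exact sub_nonneg.mp (e ▸ h)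

end Summability

/-- The standard Hilbert C⋆-module `ℓ₂(𝒜)`: the sequences `(aᵢ)` in `𝒜` for which the series
`∑ aᵢ⋆ aᵢ` converges in norm (for series of positive elements, convergence of the partial sums
is the same as unconditional convergence). -/
def l2 (𝒜 : Type*) [NonUnitalCStarAlgebra 𝒜] [PartialOrder 𝒜] [StarOrderedRing 𝒜] :
    Submodule ℂ (ℕ → 𝒜) where
  carrier := {a | Summable fun i => star (a i) * a i}
  zero_mem' := by simp [summable_zero]
  add_mem' {a b} ha hb :=
    summable_of_nonneg_of_le_cstar (fun i => star_mul_self_nonneg _)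
      (fun i => star_mul_self_add_le (a i) (b i))
      ((Summable.const_smul (2 : ℂ) ha).add (Summable.const_smul (2 : ℂ) hb))
  smul_mem' c a ha := by
    have h := Summable.const_smul (star c * c) ha
    refine h.congr fun i => ?_
    simp [smul_mul_smul_comm]

namespace l2

variable {𝒜 : Type*} [NonUnitalCStarAlgebra 𝒜] [PartialOrder 𝒜] [StarOrderedRing 𝒜]

theorem summable_self (x : l2 𝒜) : Summable fun i => star (x.1 i) * x.1 i := x.2

/-- The series defining the inner product of `ℓ₂(𝒜)` converges (polarization). -/
theorem summable_inner (x y : l2 𝒜) : Summable fun i => star (x.1 i) * y.1 i := by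
  have h1 := summable_self (x + y)
  have h2 := summable_self (x - y)
  have h3 := summable_self (x + Complex.I • y)
  have h4 := summable_self (x - Complex.I • y)
  have h := ((h1.sub h2).sub ((h3.sub h4).const_smul Complex.I)).const_smul ((4 : ℂ)⁻¹)
  refine h.congr fun i => ?_
  have hI : Complex.I * Complex.I = -1 := Complex.I_mul_I
  simp only [Submodule.coe_add, Submodule.coe_sub, Submodule.coe_smul, Pi.add_apply, Pi.sub_apply,
    Pi.smul_apply, star_add, star_sub, star_smul, add_mul, mul_add, sub_mul, mul_sub,
    smul_mul_assoc, mul_smul_comm, Complex.star_def, Complex.conj_I, smul_add, smul_sub, smul_smul]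
  match_scalars <;> ring_nf <;> norm_num

/-- The `𝒜`-valued inner product `⟨x, y⟩ = ∑ xᵢ⋆ yᵢ` of `ℓ₂(𝒜)`, linear in the second variable. -/
def inner (x y : l2 𝒜) : 𝒜 := ∑' i, star (x.1 i) * y.1 i

theorem star_inner (x y : l2 𝒜) : star (inner x y) = inner y x := by
  simp [inner, tsum_star]

theorem inner_smul_right (c : ℂ) (x y : l2 𝒜) : inner x (c • y) = c • inner x y := by
  simp only [inner, Submodule.coe_smul, Pi.smul_apply, mul_smul_comm]
  exact (summable_inner x y).tsum_const_smul c

theorem inner_smul_left (c : ℂ) (x y : l2 𝒜) : inner (c • x) y = star c • inner x y := by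
  rw [← star_inner, inner_smul_right, star_smul, star_inner]

end l2

/-- The set `𝓛(ℓ₂(𝒜))` of adjointable operators on `ℓ₂(𝒜)`: linear operators `T` together with
the (necessarily unique) operator `T⋆` such that `⟨T x, y⟩ = ⟨x, T⋆ y⟩` for all `x`, `y`. Such
operators are automatically bounded and `𝒜`-linear. -/
structure Adjointable (𝒜 : Type*) [NonUnitalCStarAlgebra 𝒜] [PartialOrder 𝒜]
    [StarOrderedRing 𝒜] where
  toLin : l2 𝒜 →ₗ[ℂ] l2 𝒜
  adj : l2 𝒜 →ₗ[ℂ] l2 𝒜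
  inner_adj : ∀ x y, l2.inner (toLin x) y = l2.inner x (adj y)

namespace Adjointable

variable {𝒜 : Type*} [NonUnitalCStarAlgebra 𝒜] [PartialOrder 𝒜] [StarOrderedRing 𝒜]

instance : CoeFun (Adjointable 𝒜) (fun _ => l2 𝒜 → l2 𝒜) := ⟨fun T => T.toLin⟩

instance : Star (Adjointable 𝒜) where
  star T :=
    { toLin := T.adj
      adj := T.toLin
      inner_adj := fun x y => by
        rw [← l2.star_inner, ← T.inner_adj, l2.star_inner] }

instance : Mul (Adjointable 𝒜) where
  mul S T :=
    { toLin := S.toLin ∘ₗ T.toLin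
      adj := T.adj ∘ₗ S.adj
      inner_adj := fun x y => by simp [S.inner_adj, T.inner_adj] }

instance : SMul ℝ (Adjointable 𝒜) where
  smul r T :=
    { toLin := (r : ℂ) • T.toLin
      adj := (r : ℂ) • T.adj
      inner_adj := fun x y => by
        rw [LinearMap.smul_apply, LinearMap.smul_apply, l2.inner_smul_left, l2.inner_smul_right,
          T.inner_adj, Complex.star_def, Complex.conj_ofReal] }

/-- The operator order: `S ≤ T` iff `T - S` is positive, i.e. `⟨S x, x⟩ ≤ ⟨T x, x⟩` in `𝒜` for
every `x`. -/
instance : LE (Adjointable 𝒜) where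
  le S T := ∀ x, l2.inner (S x) x ≤ l2.inner (T x) x

end Adjointable

section States

variable {𝒜 : Type*} [NonUnitalCStarAlgebra 𝒜] [PartialOrder 𝒜] [StarOrderedRing 𝒜]

/-- A bounded linear functional is positive if it maps positive elements to nonnegative numbers
(in the order of `ℂ`: real and nonnegative). -/
def IsPositiveFunctional (f : 𝒜 →L[ℂ] ℂ) : Prop := ∀ a, 0 ≤ a → 0 ≤ f a

/-- A pure state: a positive linear functional `f` of norm one such that every positive
functional `g ≤ f` has the form `t • f` with `t ∈ [0, 1]`. -/
structure IsPureState (f : 𝒜 →L[ℂ] ℂ) : Prop where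
  pos : IsPositiveFunctional f
  norm_eq_one : ‖f‖ = 1
  pure : ∀ g : 𝒜 →L[ℂ] ℂ, IsPositiveFunctional g → IsPositiveFunctional (f - g) →
    ∃ t : ℝ, 0 ≤ t ∧ t ≤ 1 ∧ g = (t : ℂ) • f

/-- `𝓝_{ℰ, f} = {x ∈ ℓ₂(𝒜) : f ⟨x, x⟩ = 0}`. -/
def nullSet (f : 𝒜 →L[ℂ] ℂ) : Set (l2 𝒜) := {x | f (l2.inner x x) = 0}

end States

end

/-! Write `‖x‖_f² = f ⟨x, x⟩`. For fixed `z`, Cauchy–Schwarz and `BB⋆ ≤ λAA⋆` bound `|f ⟨Bz, w⟩| =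
|f ⟨z, B⋆w⟩|` by a multiple of `‖A⋆w‖_f`. Hence `A⋆w ↦ f ⟨Bz, w⟩` is well defined and bounded, and
Riesz represents it by a vector `h` of the completion of `ℓ₂(𝒜)` for `‖·‖_f`. If `h` comes from some
`x` in `ℓ₂(𝒜)`, then `f ⟨Bz - Ax, w⟩ = 0` for all `w`, and `w = Bz - Ax` finishes.

Purity is what makes `ℓ₂(𝒜)` modulo null vectors already complete. It suffices that the module unit
ball is `‖·‖_f`-dense in the `‖·‖_f`-unit ball (`l2.exists_mem_unitBall_of_pure`): successive
approximation then writes vectors of the completion as multiples of series `∑ 2⁻ⁿ kₙ`, and these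
converge in `ℓ₂(𝒜)`.

If density fails at `x`, Hahn–Banach gives an `f`-bounded `φ` with `Re φ ≤ 1` on the module ball and
`Re φ(x) > 1`; it is controlled by a positive `ψ` of size at most one
(`l2.exists_dominating_functional`). In the GNS space of `f + ψ`, purity makes the operator that
induces `f` a positive multiple of a projection (`IsPureState.exists_approx`). Projecting moves `x`
to some `xa` at small `f`-distance with `ψ ⟨xa, xa⟩` barely above `1`, while `φ(xa)` stays above `1`
by a fixed margin: a contradiction. -/

/-! ### Riesz representation in a completion -/

section HilbertSpace

open UniformSpace InnerProductSpace

/-- Riesz representation of a functional on `W` that is bounded with respect to the seminorm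
pulled back along a linear map into a pre-Hilbert space. -/
theorem exists_completion_inner_eq {V W : Type*} [SeminormedAddCommGroup V]
    [InnerProductSpace ℂ V] [AddCommGroup W] [Module ℂ W] (T : W →ₗ[ℂ] V) (φ : W →ₗ[ℂ] ℂ) (C : ℝ)
    (hφ : ∀ w, ‖φ w‖ ≤ C * ‖T w‖) :
    ∃ h : Completion V, ∀ w, inner ℂ h (T w : Completion V) = φ w := by
  let T' : W →ₗ[ℂ] Completion V := Completion.toComplL.toLinearMap ∘ₗ T
  have hT' : ∀ w, T' w = (T w : Completion V) := fun w => rfl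
  obtain ⟨s, hs⟩ := T'.rangeRestrict.exists_rightInverse_of_surjective T'.range_rangeRestrict
  have hs' : ∀ r, T' (s r) = r := fun r => congrArg Subtype.val (LinearMap.congr_fun hs r)
  have hφ' : ∀ w, ‖φ w‖ ≤ C * ‖T' w‖ := fun w => by
    rw [hT', Completion.norm_coe]; exact hφ w
  let ψ : StrongDual ℂ (LinearMap.range T') := (φ ∘ₗ s).mkContinuous C fun r => by
    have := hφ' (s r)
    rwa [hs'] at this
  obtain ⟨g, hg, -⟩ := exists_extension_norm_eq _ ψ
  refine ⟨(toDual ℂ (Completion V)).symm g, fun w => ?_⟩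
  rw [toDual_symm_apply, ← hT']
  have h1 : g (T' w) = φ (s ⟨T' w, w, rfl⟩) := hg ⟨T' w, w, rfl⟩
  -- The bound on `φ` makes it vanish on the kernel of `T'`, so the choice of the linear section `s`
  -- does not matter.
  have h2 : ‖φ (s ⟨T' w, w, rfl⟩ - w)‖ ≤ 0 := by
    refine (hφ' _).trans_eq ?_
    rw [map_sub, hs', sub_self, norm_zero, mul_zero]
  rw [h1, ← sub_eq_zero, ← map_sub]
  exact norm_le_zero_iff.1 h2

end HilbertSpace

/-! ### GNS spaces of positive functionals -/

section PositiveFunctionals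

open Filter Topology UniformSpace

variable {𝒜 : Type*} [NonUnitalCStarAlgebra 𝒜] [PartialOrder 𝒜] [StarOrderedRing 𝒜]

namespace PositiveLinearMap

/-- Cauchy–Schwarz against an approximate unit. -/
theorem norm_apply_le_norm_toPreGNS (F : 𝒜 →ₚ[ℂ] ℂ) {K : ℝ} (hK : ∀ a, ‖F a‖ ≤ K * ‖a‖)
    (a : 𝒜) :
    ‖F a‖ ≤ √K * ‖F.toPreGNS a‖ := by
  have hlim : Tendsto (fun u => ‖F (u * a)‖) (CStarAlgebra.approximateUnit 𝒜) (𝓝 ‖F a‖) :=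
    ((map_continuous F).norm.tendsto a).comp
      ((CStarAlgebra.increasingApproximateUnit 𝒜).tendsto_mul_right a)
  refine le_of_tendsto hlim ?_
  filter_upwards [(CStarAlgebra.increasingApproximateUnit 𝒜).eventually_norm] with u hu
  -- The sign of `K` is not assumed; any nonzero `u` forces `0 ≤ K`.
  have hK0 : 0 ≤ K ∨ u = 0 := by
    by_cases h : u = 0
    · exact .inr h
    · exact .inl (nonneg_of_mul_nonneg_left ((norm_nonneg _).trans (hK u)) (norm_pos_iff.2 h))
  rcases hK0 with hK0 | rfl
  swap
  · simp; positivity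
  have h1 : ‖F.toPreGNS (star u)‖ ≤ √K := by
    refine Real.le_sqrt_of_sq_le ?_
    have h := F.preGNS_norm_sq (F.toPreGNS (star u))
    have h' := hK (u * star u)
    simp only [ofPreGNS_toPreGNS, star_star] at h
    rw [← h, CStarRing.norm_self_mul_star] at h'
    rw [norm_pow, Complex.norm_real, norm_norm] at h'
    exact h'.trans (mul_le_of_le_one_right hK0 (mul_le_one₀ hu (norm_nonneg _) hu))
  have h2 := norm_inner_le_norm (𝕜 := ℂ) (F.toPreGNS (star u)) (F.toPreGNS a)
  rw [preGNS_inner_def] at h2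
  simp only [ofPreGNS_toPreGNS, star_star] at h2
  exact h2.trans (mul_le_mul_of_nonneg_right h1 (norm_nonneg _))

/-- The cyclic vector of the GNS representation. -/
theorem exists_cyclic (F : 𝒜 →ₚ[ℂ] ℂ) :
    ∃ ξ : F.GNS, (∀ a, inner ℂ ξ (F.toPreGNS a : F.GNS) = F a) ∧
      ∀ a, F.gnsNonUnitalStarAlgHom a ξ = (F.toPreGNS a : F.GNS) := by
  obtain ⟨K, hK⟩ := F.exists_norm_apply_le
  obtain ⟨ξ, hξ⟩ := exists_completion_inner_eq F.toPreGNS.toLinearMap F.toLinearMap (√K)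
    (F.norm_apply_le_norm_toPreGNS hK)
  refine ⟨ξ, hξ, fun a => ?_⟩
  refine (Completion.denseRange_coe (α := F.PreGNS)).eq_of_inner_left (𝕜 := ℂ) ?_
  intro b
  obtain ⟨b, rfl⟩ := F.toPreGNS.surjective b
  rw [← ContinuousLinearMap.adjoint_inner_right, ← ContinuousLinearMap.star_eq_adjoint,
    ← map_star, gnsNonUnitalStarAlgHom_apply_coe, leftMulMapPreGNS_apply, ofPreGNS_toPreGNS,
    Completion.inner_coe, preGNS_inner_def]
  exact hξ _

/-- The contraction from the GNS space of a functional onto that of a smaller functional. -/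
noncomputable def gnsContraction (F f : 𝒜 →ₚ[ℂ] ℂ) (h : ∀ a, 0 ≤ a → f a ≤ F a) :
    F.GNS →L[ℂ] f.GNS :=
  ((f.toPreGNS.toLinearMap ∘ₗ F.ofPreGNS.toLinearMap).mkContinuous 1 fun x => by
    rw [one_mul, ← sq_le_sq₀ (norm_nonneg _) (norm_nonneg _), ← Complex.real_le_real]
    push_cast
    rw [preGNS_norm_sq, preGNS_norm_sq]
    exact h _ (star_mul_self_nonneg _)).completion

variable {F f : 𝒜 →ₚ[ℂ] ℂ} {h : ∀ a, 0 ≤ a → f a ≤ F a}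

theorem gnsContraction_coe (a : 𝒜) :
    gnsContraction F f h (F.toPreGNS a : F.GNS) = (f.toPreGNS a : f.GNS) := by
  simp [gnsContraction]

theorem norm_gnsContraction_le : ‖gnsContraction F f h‖ ≤ 1 := by
  refine ContinuousLinearMap.opNorm_le_bound _ zero_le_one fun x => ?_
  induction x using Completion.induction_on with
  | hp => apply isClosed_le <;> fun_prop
  | ih x =>
    rw [gnsContraction, ContinuousLinearMap.completion_apply_coe, Completion.norm_coe,
      Completion.norm_coe]
    exact (LinearMap.mkContinuous_norm_le _ zero_le_one _ |>.trans le_rfl) |>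
      (ContinuousLinearMap.le_of_opNorm_le _ · x)

/-- Intertwining holds on the dense image of `𝒜`, where both sides are left multiplication. It
places `J⋆J` in the commutant of the representation of `F`. -/
theorem gnsContraction_comp (a : 𝒜) (x : F.GNS) :
    gnsContraction F f h (F.gnsNonUnitalStarAlgHom a x) =
      f.gnsNonUnitalStarAlgHom a (gnsContraction F f h x) := by
  induction x using Completion.induction_on with
  | hp => apply isClosed_eq <;> fun_prop
  | ih x =>
    obtain ⟨b, rfl⟩ := F.toPreGNS.surjective x
    simp [gnsContraction_coe]

end PositiveLinearMap

end PositiveFunctionals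

/-! ### Pure states and the commutant of a dominating functional -/

section PureStates

open Filter Topology UniformSpace

variable {𝒜 : Type*} [NonUnitalCStarAlgebra 𝒜] [PartialOrder 𝒜] [StarOrderedRing 𝒜]

/-- A positive functional on a C⋆-algebra, as a bundled positive linear map. -/
def IsPositiveFunctional.toPositive {f : 𝒜 →L[ℂ] ℂ} (hf : IsPositiveFunctional f) : 𝒜 →ₚ[ℂ] ℂ :=
  PositiveLinearMap.mk₀ f.toLinearMap hf

theorem IsPositiveFunctional.map_star {f : 𝒜 →L[ℂ] ℂ} (hf : IsPositiveFunctional f) (a : 𝒜) :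
    f (star a) = star (f a) :=
  StarHomClass.map_star hf.toPositive a

/-- A positive functional bounded from below by a multiple of a functional of norm one is at
least as large in norm. -/
theorem IsPositiveFunctional.le_one_of_smul_le {f : 𝒜 →L[ℂ] ℂ} (hf : IsPositiveFunctional f)
    (hf1 : ‖f‖ = 1) {s : ℝ} (hs : ∀ a, s * (f (star a * a)).re ≤ ‖a‖ ^ 2) : s ≤ 1 := by
  by_contra! h
  have h0 : 0 < s := by linarith
  -- `|f a|² ≤ f (a⋆a) ≤ ‖a‖² / s`, which for `s > 1` contradicts `‖f‖ = 1`.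
  have hb : ∀ a, ‖f a‖ ≤ √(1 / s) * ‖a‖ := fun a => by
    have h1 := hf.toPositive.norm_apply_le_norm_toPreGNS (K := 1)
      (fun a => by simpa [hf1] using! f.le_opNorm a) a
    rw [Real.sqrt_one, one_mul] at h1
    refine h1.trans ?_
    rw [← Real.sqrt_sq (norm_nonneg a), ← Real.sqrt_mul (by positivity)]
    refine Real.le_sqrt_of_sq_le ?_
    have h2 := congrArg Complex.re (hf.toPositive.preGNS_norm_sq (hf.toPositive.toPreGNS a))
    rw [← Complex.ofReal_pow, Complex.ofReal_re] at h2
    rw [h2, one_div, inv_mul_eq_div, le_div_iff₀ h0, mul_comm]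
    exact hs a
  have h3 := f.opNorm_le_bound (Real.sqrt_nonneg _) hb
  rw [hf1, Real.one_le_sqrt, one_div] at h3
  exact absurd h3 (not_le.2 (inv_lt_one_of_one_lt₀ h))

/-- If `f` is a pure state and `ψ` a positive functional of norm at most one, then modulo small
`f`-seminorm any `b` can be replaced by some `b * a` whose `ψ`-seminorm is at most the `f`-seminorm
of `b`: the part of `ψ` that is singular with respect to `f` can be made small. -/
theorem IsPureState.exists_approx {f ψ : 𝒜 →L[ℂ] ℂ} (hf : IsPureState f)
    (hψ : IsPositiveFunctional ψ) (hψ1 : ∀ a, 0 ≤ a → ‖ψ a‖ ≤ ‖a‖) (b : 𝒜) {ε : ℝ} (hε : 0 < ε) :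
    ∃ a, (f (star (b - b * a) * (b - b * a))).re < ε ∧
      (ψ (star (b * a) * (b * a))).re < (f (star b * b)).re + ε := by
  have hadd : IsPositiveFunctional (f + ψ) := fun a ha => add_nonneg (hf.pos a ha) (hψ a ha)
  let f' := hf.pos.toPositive
  let F := hadd.toPositive
  have hfF : ∀ a, 0 ≤ a → f' a ≤ F a := fun a ha => le_add_of_nonneg_right (hψ a ha)
  let J := F.gnsContraction f' hfF
  -- `S` is the Radon–Nikodym derivative of `f` with respect to `F = f + ψ`.
  obtain ⟨S, hSJ⟩ : ∃ S, S = J.adjoint ∘L J := ⟨_, rfl⟩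
  obtain ⟨ξ, hξ, hπξ⟩ := F.exists_cyclic
  let j : 𝒜 →ₗ[ℂ] F.GNS := Completion.toComplL.toLinearMap ∘ₗ F.toPreGNS.toLinearMap
  let π := F.gnsNonUnitalStarAlgHom
  have hπξ : ∀ a, π a ξ = j a := hπξ
  have hξ : ∀ a, inner ℂ ξ (j a) = F a := hξ
  have hj : DenseRange j :=
    (Completion.denseRange_coe (α := F.PreGNS)).comp F.toPreGNS.surjective.denseRange
      (Completion.continuous_coe _)
  have hjj : ∀ a, ‖j a‖ ^ 2 = (f (star a * a)).re + (ψ (star a * a)).re := fun a => by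
    have h := congrArg Complex.re (F.preGNS_norm_sq (F.toPreGNS a))
    rw [← Complex.ofReal_pow, Complex.ofReal_re, ← Completion.norm_coe] at h
    exact h
  have hJJ : ∀ a b, inner ℂ (J (j a)) (J (j b)) = f (star a * b) := fun a b => by
    have h : ∀ a, J (j a) = (f'.toPreGNS a : f'.GNS) := fun a =>
      PositiveLinearMap.gnsContraction_coe a
    rw [h, h, Completion.inner_coe]
    rfl
  have hJn : ∀ a, ‖J (j a)‖ ^ 2 = (f (star a * a)).re := fun a => by
    rw [← hJJ, ← inner_self_eq_norm_sq (𝕜 := ℂ)]; rfl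
  have hS : ∀ x y, inner ℂ x (S y) = inner ℂ (J x) (J y) := fun x y => by
    rw [hSJ]; exact J.adjoint_inner_right x (J y)
  have hS' : ∀ x y, inner ℂ (S x) y = inner ℂ (J x) (J y) := fun x y => by
    rw [hSJ]; exact J.adjoint_inner_left y (J x)
  have hπj : ∀ a b, π a (j b) = j (a * b) := fun a b =>
    PositiveLinearMap.gnsNonUnitalStarAlgHom_apply_coe F
  have hπ : ∀ a x y, inner ℂ x (π (star a) y) = inner ℂ (π a x) y := fun a x y => by
    rw [map_star, ContinuousLinearMap.star_eq_adjoint, ContinuousLinearMap.adjoint_inner_right]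
  have hSπ : ∀ a x, S (π a x) = π a (S x) := fun a x => by
    refine ext_inner_left ℂ fun y => ?_
    have hJπ : ∀ a x, J (π a x) = f'.gnsNonUnitalStarAlgHom a (J x) := fun a x =>
      PositiveLinearMap.gnsContraction_comp a x
    rw [← star_star a, hS, hJπ, hπ, hS, hJπ, map_star, ContinuousLinearMap.star_eq_adjoint,
      ContinuousLinearMap.adjoint_inner_right]
  have hSS : ∀ x, ‖S x‖ ≤ ‖J x‖ := fun x => by
    have h : ‖J.adjoint‖ ≤ 1 := by
      rw [LinearIsometryEquiv.norm_map]; exact PositiveLinearMap.norm_gnsContraction_le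
    simpa [hSJ] using J.adjoint.le_of_opNorm_le h (J x)
  have hq : ∀ a b, inner ℂ ξ ((S - S ∘L S) (j (star a * b))) =
      inner ℂ (j a) (S (j b)) - inner ℂ (S (j a)) (S (j b)) := fun a b => by
    rw [← hπj, sub_apply, ContinuousLinearMap.comp_apply, hSπ, hSπ, ← map_sub,
      hπ, hπξ, inner_sub_right, hS (j a) (S (j b)), hS' (j a) (S (j b))]
  -- The test functional for purity is `⟨ξ, (S - S²) π(·) ξ⟩`. At `b⋆b` it equals `‖J j(b)‖² - ‖S
  -- j(b)‖²`, so it lies between `0` and `f`. Then `g = t • f` reads `S - S² = tS`, so `S = rP` with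
  -- `r = 1 - t` and `P` a projection.
  let g : 𝒜 →ₚ[ℂ] ℂ := PositiveLinearMap.mk₀
    ((innerSL ℂ ξ ∘L (S - S ∘L S)).toLinearMap ∘ₗ j) fun a ha => by
      obtain ⟨b, rfl⟩ := CStarAlgebra.nonneg_iff_eq_star_mul_self.1 ha
      change 0 ≤ inner ℂ ξ ((S - S ∘L S) (j (star b * b)))
      rw [hq, hS, inner_self_eq_norm_sq_to_K, inner_self_eq_norm_sq_to_K, sub_nonneg]
      have := hSS (j b)
      simp only [Complex.coe_algebraMap, ← Complex.ofReal_pow, Complex.real_le_real]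
      gcongr
  have hg : ∀ a b, g (star a * b) = inner ℂ (j a) (S (j b)) - inner ℂ (S (j a)) (S (j b)) := hq
  obtain ⟨t, ht0, ht1, hgt⟩ := hf.pure ⟨g.toLinearMap, map_continuous g⟩
      (fun a ha => g.map_nonneg ha) fun a ha => by
    obtain ⟨b, rfl⟩ := CStarAlgebra.nonneg_iff_eq_star_mul_self.1 ha
    change 0 ≤ f (star b * b) - g (star b * b)
    rw [hg, hS, hJJ, sub_sub_cancel, inner_self_eq_norm_sq_to_K]
    change (0 : ℂ) ≤ ((‖S (j b)‖ : ℝ) : ℂ) ^ 2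
    rw [← Complex.ofReal_pow, Complex.zero_le_real]
    positivity
  have hgt' : ∀ a b, g (star a * b) = t * f (star a * b) := fun a b => by
    have := DFunLike.congr_fun hgt (star a * b)
    simpa using this
  set r : ℝ := 1 - t with hr
  have hSt : ∀ b, S (S (j b)) = (r : ℂ) • S (j b) := fun b => by
    refine hj.eq_of_inner_right (𝕜 := ℂ) fun a => ?_
    have h := hgt' a b
    rw [hg, hS' (j a), ← hS (j a), ← hJJ, ← hS] at h
    rw [inner_smul_right, hr]
    push_cast
    linear_combination -h
  -- If `r = 0`, then `S² = 0`, so `S = 0` and `J = 0`; then `f (a⋆a) = 0` for all `a`, against `‖f‖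
  -- = 1`.
  have hr0 : 0 < r := by
    refine lt_of_le_of_ne (by linarith) fun h0 => ?_
    have hJ0 : ∀ b, J (j b) = 0 := fun b => by
      have h1 : S (j b) = 0 := by
        rw [← inner_self_eq_zero (𝕜 := ℂ), hS' (j b), ← hS, hSt, ← h0]
        simp
      rw [← inner_self_eq_zero (𝕜 := ℂ), ← hS, h1, inner_zero_right]
    have h1 := hf.pos.le_one_of_smul_le hf.norm_eq_one (s := 2) fun a => by
      rw [← hJn, hJ0, norm_zero]
      nlinarith [norm_nonneg a]
    norm_num at h1
  -- `v a` is the projection `P j(a)`. It has the same image under `J` as `j a`, and its squared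
  -- norm is `r⁻¹ f (a⋆a)`.
  let v : 𝒜 → F.GNS := fun a => ((r⁻¹ : ℝ) : ℂ) • S (j a)
  have hJv : ∀ a, J (v a) = J (j a) := fun a => by
    rw [← sub_eq_zero, ← map_sub, ← inner_self_eq_zero (𝕜 := ℂ), ← hS]
    have : S (v a - j a) = 0 := by
      rw [map_sub, map_smul, hSt, smul_smul, ← Complex.ofReal_mul, inv_mul_cancel₀ hr0.ne']
      simp
    rw [this, inner_zero_right]
  have hvj : ∀ a x, inner ℂ (v a) x = ((r⁻¹ : ℝ) : ℂ) * inner ℂ (J (j a)) (J x) := fun a x => by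
    rw [inner_smul_left, hS', Complex.conj_ofReal]
  have hvn : ∀ a, ‖v a‖ ^ 2 = r⁻¹ * (f (star a * a)).re := fun a => by
    rw [← inner_self_eq_norm_sq (𝕜 := ℂ), hvj, hJv, hJJ]
    exact Complex.re_ofReal_mul _ _
  have hvle : ∀ a, ‖v a‖ ≤ ‖j a‖ := fun a => by
    have h1 : inner ℂ (v a) (v a) = inner ℂ (v a) (j a) := by rw [hvj, hvj, hJv]
    have h2 := norm_inner_le_norm (𝕜 := ℂ) (v a) (j a)
    rw [← h1] at h2
    have h3 := (Complex.re_le_norm _).trans h2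
    have h4 : (inner ℂ (v a) (v a)).re = ‖v a‖ * ‖v a‖ :=
      inner_self_eq_norm_mul_norm (𝕜 := ℂ) (v a)
    rw [h4] at h3
    nlinarith [norm_nonneg (v a), norm_nonneg (j a)]
  -- From `‖v a‖ ≤ ‖j a‖`, `(r⁻¹ - 1) f (a⋆a) ≤ ψ (a⋆a) ≤ ‖a‖²`.
  have hs : r⁻¹ - 1 ≤ 1 := hf.pos.le_one_of_smul_le hf.norm_eq_one fun a => by
    have h1 := hψ1 _ (star_mul_self_nonneg a)
    rw [CStarRing.norm_star_mul_self] at h1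
    have h2 := (Complex.re_le_norm _).trans h1
    have h3 := pow_le_pow_left₀ (norm_nonneg _) (hvle a) 2
    rw [hvn, hjj] at h3
    nlinarith
  have hπv : π b (((r⁻¹ : ℝ) : ℂ) • S ξ) = v b := by
    rw [map_smul, ← hSπ, hπξ]
  have hfb : 0 ≤ (f (star b * b)).re := by rw [← hJn]; positivity
  -- `‖z‖² - ‖J z‖²` extends the `ψ`-seminorm squared. Both conditions are open and hold at `z = P
  -- ξ`, where `π(b) z = v b`, so some `j a` in the dense range satisfies them too.
  have hopen : IsOpen {z | ‖J (j b - π b z)‖ ^ 2 < ε ∧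
      ‖π b z‖ ^ 2 - ‖J (π b z)‖ ^ 2 < (f (star b * b)).re + ε} := by
    rw [Set.ofPred_and]
    exact (isOpen_lt (by fun_prop) continuous_const).inter
      (isOpen_lt (by fun_prop) continuous_const)
  obtain ⟨a, ha1, ha2⟩ := hj.exists_mem_open hopen ⟨((r⁻¹ : ℝ) : ℂ) • S ξ, by
    refine ⟨?_, ?_⟩
    · rw [hπv, map_sub, hJv, sub_self, norm_zero]
      simpa using hε
    · rw [hπv, hJv, hvn, hJn]
      nlinarith⟩
  rw [hπj] at ha1 ha2
  refine ⟨a, ?_, ?_⟩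
  · rwa [← map_sub, hJn] at ha1
  · rwa [hjj, hJn, add_sub_cancel_left] at ha2

end PureStates

/-! ### Semi-inner products: separation and completeness -/

section CoreLemmas

open Filter Topology UniformSpace

variable {V : Type*} [AddCommGroup V] [Module ℂ V]

/-- Separation of a point from a convex set containing `0`, in a pre-Hilbert space. -/
theorem PreInnerProductSpace.Core.exists_separating (c : PreInnerProductSpace.Core ℂ V) {K : Set V}
    (hK : Convex ℝ K) (h0 : (0 : V) ∈ K) {x : V} {ε : ℝ} (hε : 0 < ε)
    (hx : ∀ k ∈ K, ε ≤ (c.inner (x - k) (x - k)).re) :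
    ∃ (φ : V →ₗ[ℂ] ℂ) (C : ℝ), (∀ k ∈ K, (φ k).re ≤ 1) ∧ 1 < (φ x).re ∧
      ∀ v, ‖φ v‖ ≤ C * √(c.inner v v).re := by
  let := InnerProductSpace.Core.toSeminormedAddCommGroup (c := c)
  let : InnerProductSpace ℂ V := InnerProductSpace.ofCore c
  have hn : ∀ v : V, ‖v‖ = √(c.inner v v).re := fun v => rfl
  have hxK : x ∉ closure K := fun h => by
    obtain ⟨k, hk, hxk⟩ := Metric.mem_closure_iff.1 h (√ε) (Real.sqrt_pos.2 hε)
    rw [dist_eq_norm, hn, Real.sqrt_lt_sqrt_iff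
      (show 0 ≤ (c.inner _ _).re from c.re_inner_nonneg _)] at hxk
    exact absurd (hx k hk) (not_le.2 hxk)
  obtain ⟨g, u, hgu, hgx⟩ :=
    RCLike.geometric_hahn_banach_closed_point (𝕜 := ℂ) hK.closure isClosed_closure hxK
  have hu : 0 < u := by simpa using hgu 0 (subset_closure h0)
  refine ⟨((u⁻¹ : ℝ) : ℂ) • g.toLinearMap, u⁻¹ * ‖g‖, fun k hk => ?_, ?_, fun v => ?_⟩
  · have := hgu k (subset_closure hk)
    rw [LinearMap.smul_apply, smul_eq_mul, Complex.re_ofReal_mul, inv_mul_eq_div, div_le_one hu]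
    exact this.le
  · rw [LinearMap.smul_apply, smul_eq_mul, Complex.re_ofReal_mul, inv_mul_eq_div, one_lt_div hu]
    exact hgx
  · rw [LinearMap.smul_apply, norm_smul, Complex.norm_real, Real.norm_of_nonneg (by positivity),
      mul_assoc]
    exact mul_le_mul_of_nonneg_left (g.le_opNorm v) (by positivity)

/-- If the unit ball of a pre-Hilbert space is contained in the closure of a set `K` for which all
series `∑ 2⁻ⁿ kₙ` with `kₙ ∈ K` converge, then the Riesz representation theorem holds without
completing the space. -/
theorem PreInnerProductSpace.Core.exists_inner_eq (c : PreInnerProductSpace.Core ℂ V) {K : Set V}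
    (hd : ∀ x, (c.inner x x).re ≤ 1 → ∀ ε > 0, ∃ k ∈ K, (c.inner (x - k) (x - k)).re < ε)
    (hc : ∀ k : ℕ → V, (∀ n, k n ∈ K) → ∃ v, Tendsto (fun n =>
      (c.inner (v - ∑ i ∈ Finset.range n, (2⁻¹ : ℂ) ^ i • k i)
        (v - ∑ i ∈ Finset.range n, (2⁻¹ : ℂ) ^ i • k i)).re) atTop (𝓝 0))
    {W : Type*} [AddCommGroup W] [Module ℂ W] (T : W →ₗ[ℂ] V) (φ : W →ₗ[ℂ] ℂ) (C : ℝ)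
    (hφ : ∀ w, ‖φ w‖ ≤ C * √(c.inner (T w) (T w)).re) :
    ∃ v, ∀ w, c.inner v (T w) = φ w := by
  let := InnerProductSpace.Core.toSeminormedAddCommGroup (c := c)
  let : InnerProductSpace ℂ V := InnerProductSpace.ofCore c
  have hn : ∀ v : V, ‖v‖ = √(c.inner v v).re := fun v => rfl
  obtain ⟨h, hh⟩ := exists_completion_inner_eq T φ C hφ
  suffices H : ∃ v : V, (v : Completion V) = h by
    obtain ⟨v, rfl⟩ := H
    exact ⟨v, fun w => by rw [← hh, Completion.inner_coe]⟩
  clear hh hφ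
  -- Error budget: `1/8` for replacing `2y` by `v`, `1/8` for shrinking `v` into the unit ball by
  -- `8/9`, and `√(1/16) = 1/4` for `k`, in total `1/2`.
  have happrox : ∀ y : Completion V, ‖y‖ ≤ 2⁻¹ →
      ∃ k ∈ K, ‖(2 : ℂ) • y - (k : Completion V)‖ ≤ 2⁻¹ := by
    intro y hy
    obtain ⟨_, ⟨v, rfl⟩, hv⟩ := Metric.mem_closure_iff.1
      ((Completion.denseRange_coe (α := V)) ((2 : ℂ) • y)) 8⁻¹ (by norm_num)
    rw [dist_eq_norm] at hv
    have hy2 : ‖(2 : ℂ) • y‖ ≤ 1 := by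
      rw [norm_smul, Complex.norm_two]
      linarith
    have hvn : ‖v‖ ≤ 9 / 8 := by
      have := norm_sub_norm_le (v : Completion V) ((2 : ℂ) • y)
      rw [norm_sub_rev, Completion.norm_coe] at this
      linarith
    have hv1 : ‖(8 / 9 : ℂ) • v‖ ≤ 1 := by
      rw [norm_smul]
      norm_num
      linarith
    have hv2 : ‖v - (8 / 9 : ℂ) • v‖ ≤ 8⁻¹ := by
      have : v - (8 / 9 : ℂ) • v = (1 / 9 : ℂ) • v := by module
      rw [this, norm_smul]
      norm_num
      linarith
    obtain ⟨k, hkK, hk⟩ := hd ((8 / 9 : ℂ) • v) (by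
      rwa [hn, Real.sqrt_le_left zero_le_one, one_pow] at hv1) (16⁻¹) (by norm_num)
    refine ⟨k, hkK, ?_⟩
    have hk' : ‖(8 / 9 : ℂ) • v - k‖ ≤ 4⁻¹ := by
      rw [hn, Real.sqrt_le_left (by norm_num)]
      norm_num at hk ⊢
      exact hk.le
    have e : (2 : ℂ) • y - (k : Completion V) = ((2 : ℂ) • y - (v : Completion V)) +
        ((v - (8 / 9 : ℂ) • v : V) : Completion V) +
        (((8 / 9 : ℂ) • v - k : V) : Completion V) := by
      rw [Completion.coe_sub, Completion.coe_sub]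
      abel
    rw [e]
    refine (norm_add₃_le).trans ?_
    rw [Completion.norm_coe, Completion.norm_coe]
    linarith
  have hball : ∀ y : Completion V, ‖y‖ ≤ 2⁻¹ → ∃ v : V, (v : Completion V) = (2 : ℂ) • y := by
    intro y hy
    choose! k hkK hk using happrox
    -- Doubling the error at each step keeps every `z n` in the ball of radius `1/2`, so the same
    -- approximation applies again; the true remainder after `n` steps is `2⁻ⁿ • 2 z n`.
    let z : ℕ → Completion V := fun n => n.rec y fun _ w => (2 : ℂ) • w - (k w : Completion V)
    have hz : ∀ n, ‖z n‖ ≤ 2⁻¹ := fun n => by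
      induction n with
      | zero => exact hy
      | succ n ih => exact hk _ ih
    have hzs : ∀ n, z (n + 1) = (2 : ℂ) • z n - (k (z n) : Completion V) := fun n => rfl
    have hsum : ∀ n, (2 : ℂ) • y -
        ((∑ i ∈ Finset.range n, (2⁻¹ : ℂ) ^ i • k (z i) : V) : Completion V) =
        (2⁻¹ : ℂ) ^ n • ((2 : ℂ) • z n) := fun n => by
      induction n with
      | zero => simpa [z] using Completion.coe_zero
      | succ n ih =>
        rw [Finset.sum_range_succ, Completion.coe_add, ← sub_sub, ih, Completion.coe_smul, hzs,
          ← smul_sub, smul_smul _ (2 : ℂ) (_ - _), pow_succ, mul_assoc, inv_mul_cancel₀ two_ne_zero,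
          mul_one]
    obtain ⟨v, hv⟩ := hc (fun n => k (z n)) fun n => hkK _ (hz n)
    refine ⟨v, ?_⟩
    have h1 : Tendsto (fun n =>
        ((∑ i ∈ Finset.range n, (2⁻¹ : ℂ) ^ i • k (z i) : V) : Completion V))
        atTop (𝓝 (v : Completion V)) := by
      refine (Completion.continuous_coe V).tendsto v |>.comp ?_
      rw [tendsto_iff_norm_sub_tendsto_zero]
      have h2 := hv.sqrt
      rw [Real.sqrt_zero] at h2
      refine h2.congr fun n => ?_
      rw [norm_sub_rev, hn]
    have h2 : Tendsto (fun n =>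
        ((∑ i ∈ Finset.range n, (2⁻¹ : ℂ) ^ i • k (z i) : V) : Completion V))
        atTop (𝓝 ((2 : ℂ) • y)) := by
      rw [tendsto_iff_norm_sub_tendsto_zero]
      have h3 := tendsto_pow_atTop_nhds_zero_of_lt_one (r := (2⁻¹ : ℝ)) (by norm_num) (by norm_num)
      refine squeeze_zero (fun _ => norm_nonneg _) (fun n => ?_) h3
      rw [norm_sub_rev, hsum, norm_smul, norm_smul, norm_pow, norm_inv, Complex.norm_two]
      refine mul_le_of_le_one_right (by positivity) ?_
      linarith [hz n]
    exact tendsto_nhds_unique h1 h2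
  obtain ⟨v, hv⟩ := hball (((2 * (‖h‖ + 1))⁻¹ : ℝ) • h) (by
    rw [norm_smul, Real.norm_of_nonneg (by positivity), inv_mul_le_iff₀ (by positivity)]
    linarith [norm_nonneg h])
  refine ⟨((‖h‖ + 1 : ℝ) : ℂ) • v, ?_⟩
  have h0 : ‖h‖ + 1 ≠ 0 := by positivity
  rw [Completion.coe_smul, hv, ← Complex.coe_smul, smul_smul, smul_smul]
  convert one_smul ℂ h using 2
  have h0' : ((‖h‖ : ℂ) + 1) ≠ 0 := by exact_mod_cast h0
  push_cast
  field_simp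

end CoreLemmas

/-! ### Convexity and completeness of the standard module -/

namespace l2

open Filter Topology

variable {𝒜 : Type*} [NonUnitalCStarAlgebra 𝒜] [PartialOrder 𝒜] [StarOrderedRing 𝒜]

theorem inner_add_right (x y z : l2 𝒜) : inner x (y + z) = inner x y + inner x z := by
  simp only [inner, Submodule.coe_add, Pi.add_apply, mul_add]
  exact (summable_inner x y).tsum_add (summable_inner x z)

theorem inner_add_left (x y z : l2 𝒜) : inner (x + y) z = inner x z + inner y z := by
  rw [← star_inner, inner_add_right, star_add, star_inner, star_inner]

theorem inner_neg_right (x y : l2 𝒜) : inner x (-y) = -inner x y := by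
  rw [← neg_one_smul ℂ y, inner_smul_right, neg_one_smul]

theorem inner_neg_left (x y : l2 𝒜) : inner (-x) y = -inner x y := by
  rw [← star_inner, inner_neg_right, star_neg, star_inner]

theorem inner_sub_right (x y z : l2 𝒜) : inner x (y - z) = inner x y - inner x z := by
  rw [sub_eq_add_neg, inner_add_right, inner_neg_right, sub_eq_add_neg]

theorem inner_sub_left (x y z : l2 𝒜) : inner (x - y) z = inner x z - inner y z := by
  rw [sub_eq_add_neg, inner_add_left, inner_neg_left, sub_eq_add_neg]

theorem inner_self_nonneg (x : l2 𝒜) : 0 ≤ inner x x :=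
  tsum_nonneg fun _ => star_mul_self_nonneg _

theorem inner_zero_left (x : l2 𝒜) : inner 0 x = 0 := by
  rw [← zero_smul ℂ (0 : l2 𝒜), inner_smul_left]; simp

theorem real_smul_eq (r : ℝ) (x : l2 𝒜) : r • x = (r : ℂ) • x := (Complex.coe_smul r x).symm

/-- The difference of the two sides is exactly `ab ⟨x - y, x - y⟩`. -/
theorem inner_convex (x y : l2 𝒜) {a b : ℝ} (ha : 0 ≤ a) (hb : 0 ≤ b) (hab : a + b = 1) :
    inner (a • x + b • y) (a • x + b • y) ≤ a • inner x x + b • inner y y := by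
  have h : 0 ≤ (a * b) • inner (x - y) (x - y) :=
    smul_nonneg (mul_nonneg ha hb) (inner_self_nonneg _)
  rw [← sub_nonneg]
  convert h using 1
  obtain rfl : b = 1 - a := by linarith
  simp only [real_smul_eq, inner_add_left, inner_add_right, inner_sub_left, inner_sub_right,
    inner_smul_left, inner_smul_right, Complex.star_def, Complex.conj_ofReal]
  simp only [← Complex.coe_smul]
  push_cast
  module

variable (𝒜) in
/-- The closed unit ball of `ℓ₂(𝒜)`. -/
def unitBall : Set (l2 𝒜) := {x | ‖inner x x‖ ≤ 1}

theorem zero_mem_unitBall : (0 : l2 𝒜) ∈ unitBall 𝒜 := by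
  simp [unitBall, inner_zero_left]

theorem norm_inner_real_smul (r : ℝ) (x : l2 𝒜) :
    ‖inner (r • x) (r • x)‖ = r ^ 2 * ‖inner x x‖ := by
  rw [real_smul_eq, inner_smul_left, inner_smul_right, norm_smul, norm_smul, norm_star,
    Complex.norm_real, ← mul_assoc, ← sq, Real.norm_eq_abs, sq_abs]

theorem convex_unitBall : Convex ℝ (unitBall 𝒜) := by
  intro x hx y hy a b ha hb hab
  have h := CStarAlgebra.norm_le_norm_of_nonneg_of_le (inner_self_nonneg _)
    (inner_convex x y ha hb hab)
  refine h.trans ((norm_add_le _ _).trans ?_)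
  rw [norm_smul, norm_smul, Real.norm_of_nonneg ha, Real.norm_of_nonneg hb, ← hab]
  have hx : ‖inner x x‖ ≤ 1 := hx
  have hy : ‖inner y y‖ ≤ 1 := hy
  nlinarith

theorem sum_le_inner_self (x : l2 𝒜) (t : Finset ℕ) :
    ∑ i ∈ t, star (x.1 i) * x.1 i ≤ inner x x :=
  (summable_self x).sum_le_tsum t fun _ _ => star_mul_self_nonneg _

theorem norm_sum_le (x : l2 𝒜) (t : Finset ℕ) :
    ‖∑ i ∈ t, star (x.1 i) * x.1 i‖ ≤ ‖inner x x‖ :=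
  CStarAlgebra.norm_le_norm_of_nonneg_of_le
    (Finset.sum_nonneg fun _ _ => star_mul_self_nonneg _) (sum_le_inner_self x t)

theorem norm_apply_sq_le (x : l2 𝒜) (i : ℕ) : ‖x.1 i‖ ^ 2 ≤ ‖inner x x‖ := by
  have := norm_sum_le x {i}
  rwa [Finset.sum_singleton, CStarRing.norm_star_mul_self, ← sq] at this

/-- A sequence whose partial differences are controlled converges in `ℓ₂(𝒜)`. -/
theorem exists_norm_inner_sub_le {s : ℕ → l2 𝒜} {r : ℕ → ℝ} (hr : Tendsto r atTop (𝓝 0))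
    (hs : ∀ m n, m ≤ n → ‖inner (s n - s m) (s n - s m)‖ ≤ r m) :
    ∃ v : l2 𝒜, ∀ m, ‖inner (v - s m) (v - s m)‖ ≤ r m := by
  have hcau : ∀ i, CauchySeq fun n => (s n).1 i := fun i => by
    refine cauchySeq_of_le_tendsto_0' (fun n => √(r n)) (fun n m hnm => ?_)
      (by simpa using hr.sqrt)
    rw [dist_comm, dist_eq_norm]
    exact Real.le_sqrt_of_sq_le ((norm_apply_sq_le (s m - s n) i).trans (hs n m hnm))
  choose w hw using fun i => cauchySeq_tendsto_of_complete (hcau i)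
  -- The bound on finite partial sums is uniform in `t`, so it survives first the coordinatewise
  -- limit in `n` and later the limit over `t`.
  have hsum : ∀ m t, ‖∑ i ∈ t, star (w i - (s m).1 i) * (w i - (s m).1 i)‖ ≤ r m := fun m t => by
    have h1 : Tendsto (fun n => ‖∑ i ∈ t, star ((s n).1 i - (s m).1 i) * ((s n).1 i - (s m).1 i)‖)
        atTop (𝓝 ‖∑ i ∈ t, star (w i - (s m).1 i) * (w i - (s m).1 i)‖) :=
      (tendsto_finsetSum t fun i _ =>
        ((hw i).sub_const _).star.mul ((hw i).sub_const _)).norm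
    refine le_of_tendsto h1 ?_
    filter_upwards [eventually_ge_atTop m] with n hn
    exact (norm_sum_le (s n - s m) t).trans (hs m n hn)
  have hmem : w ∈ l2 𝒜 := by
    change Summable fun i => star (w i) * w i
    rw [summable_iff_vanishing_norm]
    intro ε hε
    obtain ⟨m, hm⟩ := (hr.eventually (gt_mem_nhds (show 0 < ε / 4 by positivity))).exists
    obtain ⟨S, hS⟩ := summable_iff_vanishing_norm.1 (summable_self (s m)) (ε / 4) (by positivity)
    refine ⟨S, fun t ht => ?_⟩
    have h1 : ∑ i ∈ t, star (w i) * w i ≤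
        (2 : ℂ) • ∑ i ∈ t, star (w i - (s m).1 i) * (w i - (s m).1 i) +
          (2 : ℂ) • ∑ i ∈ t, star ((s m).1 i) * (s m).1 i := by
      rw [Finset.smul_sum, Finset.smul_sum, ← Finset.sum_add_distrib]
      refine Finset.sum_le_sum fun i _ => ?_
      simpa using star_mul_self_add_le (w i - (s m).1 i) ((s m).1 i)
    have h2 := CStarAlgebra.norm_le_norm_of_nonneg_of_le
      (Finset.sum_nonneg fun _ _ => star_mul_self_nonneg _) h1
    have h3 := norm_add_le ((2 : ℂ) • ∑ i ∈ t, star (w i - (s m).1 i) * (w i - (s m).1 i))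
      ((2 : ℂ) • ∑ i ∈ t, star ((s m).1 i) * (s m).1 i)
    rw [norm_smul, norm_smul, Complex.norm_two] at h3
    linarith [hsum m t, hS t ht]
  refine ⟨⟨w, hmem⟩, fun m => ?_⟩
  have h := (summable_self (⟨w, hmem⟩ - s m : l2 𝒜)).hasSum
  rw [HasSum] at h
  exact le_of_tendsto h.norm (.of_forall fun t => hsum m t)

theorem exists_tendsto_sum (k : ℕ → l2 𝒜) (hk : ∀ n, k n ∈ unitBall 𝒜) :
    ∃ v : l2 𝒜, Tendsto (fun n =>
      inner (v - ∑ i ∈ Finset.range n, (2⁻¹ : ℂ) ^ i • k i)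
        (v - ∑ i ∈ Finset.range n, (2⁻¹ : ℂ) ^ i • k i)) atTop (𝓝 0) := by
  set s : ℕ → l2 𝒜 := fun n => ∑ i ∈ Finset.range n, (2⁻¹ : ℂ) ^ i • k i with hs
  set r : ℕ → ℝ := fun m => 4 * ((2⁻¹ : ℝ) ^ m) ^ 2 with hr
  have hr0 : Tendsto r atTop (𝓝 0) := by
    have h3 := tendsto_pow_atTop_nhds_zero_of_lt_one (r := (2⁻¹ : ℝ)) (by norm_num) (by norm_num)
    have h4 := (h3.pow 2).const_mul 4
    rwa [zero_pow two_ne_zero, mul_zero] at h4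
  -- The scalar is `∑ 2⁻ⁱ` over `m ≤ i < m + d`, so `y` is a weighted average of the `k i` and stays
  -- in the ball by convexity. With `2⁻ᵐ` factored out, the old weight is `2 - 2 · 2⁻ᵈ` and the new
  -- one `2⁻ᵈ`.
  have hdiff : ∀ d m, ∃ y ∈ unitBall 𝒜, s (m + d) - s m =
      (2 * (2⁻¹ : ℝ) ^ m * (1 - (2⁻¹ : ℝ) ^ d)) • y := fun d m => by
    induction d with
    | zero => exact ⟨0, zero_mem_unitBall, by simp⟩
    | succ d ih =>
      obtain ⟨y, hy, e⟩ := ih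
      have h1 : (2⁻¹ : ℝ) ^ d ≤ 1 := pow_le_one₀ (by norm_num) (by norm_num)
      have h2 : (0 : ℝ) < (2⁻¹ : ℝ) ^ d := by positivity
      have h3 : (0 : ℝ) < (2⁻¹ : ℝ) ^ m := by positivity
      have h4 : (0 : ℝ) < 2 - (2⁻¹ : ℝ) ^ d := by linarith
      refine ⟨((2 - 2 * (2⁻¹ : ℝ) ^ d) / (2 - (2⁻¹ : ℝ) ^ d)) • y +
        ((2⁻¹ : ℝ) ^ d / (2 - (2⁻¹ : ℝ) ^ d)) • k (m + d),
        convex_unitBall hy (hk _) (div_nonneg (by linarith) h4.le) (by positivity)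
          (by rw [← add_div]; exact (div_eq_one_iff_eq h4.ne').2 (by ring)), ?_⟩
      have e2 : s (m + (d + 1)) = s (m + d) + (2⁻¹ : ℂ) ^ (m + d) • k (m + d) :=
        Finset.sum_range_succ _ _
      have e3 : (2⁻¹ : ℂ) ^ (m + d) • k (m + d) = ((2⁻¹ : ℝ) ^ (m + d)) • k (m + d) := by
        rw [real_smul_eq]; push_cast; rfl
      rw [e2, add_sub_right_comm, e, e3, smul_add, smul_smul, smul_smul]
      rw [pow_succ (2⁻¹ : ℝ) d, pow_add (2⁻¹ : ℝ) m d]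
      generalize (2⁻¹ : ℝ) ^ d = p at *
      generalize (2⁻¹ : ℝ) ^ m = q at *
      congr 2 <;> field_simp
  obtain ⟨v, hv⟩ := exists_norm_inner_sub_le hr0 (s := s) fun m n hmn => by
    obtain ⟨d, rfl⟩ := Nat.exists_eq_add_of_le hmn
    obtain ⟨y, hy, e⟩ := hdiff d m
    have hy : ‖inner y y‖ ≤ 1 := hy
    rw [e, norm_inner_real_smul]
    have h1 : (2⁻¹ : ℝ) ^ d ≤ 1 := pow_le_one₀ (by norm_num) (by norm_num)
    have h2 : (0 : ℝ) < (2⁻¹ : ℝ) ^ d := by positivity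
    have h3 : (0 : ℝ) < (2⁻¹ : ℝ) ^ m := by positivity
    have h4 : 2 * (2⁻¹ : ℝ) ^ m * (1 - (2⁻¹ : ℝ) ^ d) ≤ 2 * (2⁻¹ : ℝ) ^ m :=
      mul_le_of_le_one_right (by positivity) (by linarith)
    have h5 : 0 ≤ 2 * (2⁻¹ : ℝ) ^ m * (1 - (2⁻¹ : ℝ) ^ d) :=
      mul_nonneg (by positivity) (by linarith)
    calc _ ≤ (2 * (2⁻¹ : ℝ) ^ m) ^ 2 * 1 := by gcongr
      _ = r m := by rw [hr]; ring
  exact ⟨v, squeeze_zero_norm hv hr0⟩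

end l2

/-! ### Density of the module unit ball for a pure state -/

namespace l2

open Filter Topology

variable {𝒜 : Type*} [NonUnitalCStarAlgebra 𝒜] [PartialOrder 𝒜] [StarOrderedRing 𝒜]

/-- The right action of `𝒜` on `ℓ₂(𝒜)`. -/
def mulRight (x : l2 𝒜) (a : 𝒜) : l2 𝒜 :=
  ⟨fun i => x.1 i * a, by
    change Summable fun i => star (x.1 i * a) * (x.1 i * a)
    refine (((summable_self x).mul_left (star a)).mul_right a).congr fun i => ?_
    simp only [star_mul, mul_assoc]⟩

theorem inner_mulRight_right (x y : l2 𝒜) (a : 𝒜) : inner x (mulRight y a) = inner x y * a := by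
  rw [inner, inner, ← (summable_inner x y).tsum_mul_right]
  simp only [mulRight, mul_assoc]

theorem inner_mulRight_left (x y : l2 𝒜) (a : 𝒜) :
    inner (mulRight x a) y = star a * inner x y := by
  rw [← star_inner, inner_mulRight_right, star_mul, star_inner]

/-- A functional on `ℓ₂(𝒜)` of norm at most one is dominated by a positive functional on `𝒜` of
norm at most one. -/
theorem exists_dominating_functional (φ : l2 𝒜 →ₗ[ℂ] ℂ) (hφ : ∀ y ∈ unitBall 𝒜, (φ y).re ≤ 1)
    {x : l2 𝒜} (hx : 1 ≤ (φ x).re) :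
    ∃ ψ : 𝒜 →L[ℂ] ℂ, IsPositiveFunctional ψ ∧ (∀ a, 0 ≤ a → ‖ψ a‖ ≤ ‖a‖) ∧
      ∀ y, 1 ≤ (φ y).re → 1 ≤ (ψ (inner y y)).re := by
  have hre : ∀ (r : ℝ) y, (φ (r • y)).re = r * (φ y).re := fun r y => by
    rw [real_smul_eq, map_smul, smul_eq_mul, Complex.re_ofReal_mul]
  let C : Set 𝒜 := {k | ∃ y, 1 ≤ (φ y).re ∧ inner y y ≤ k}
  have hC : Convex ℝ C := by
    rintro k ⟨y, hy, hyk⟩ l ⟨z, hz, hzl⟩ a b ha hb hab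
    refine ⟨a • y + b • z, ?_, (inner_convex y z ha hb hab).trans ?_⟩
    · rw [map_add, Complex.add_re, hre, hre]
      nlinarith
    · exact add_le_add (smul_le_smul_of_nonneg_left hyk ha) (smul_le_smul_of_nonneg_left hzl hb)
  -- If `‖⟨y, y⟩‖ < 1`, some `s • y` with `s > 1` is still in the unit ball, yet `Re φ(s • y) ≥ s >
  -- 1`.
  have hdisj : Disjoint (Metric.ball (0 : 𝒜) 1) C := by
    rw [Set.disjoint_left]
    rintro k hk ⟨y, hy, hyk⟩
    rw [mem_ball_zero_iff] at hk
    have h1 : ‖inner y y‖ < 1 :=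
      (CStarAlgebra.norm_le_norm_of_nonneg_of_le (inner_self_nonneg y) hyk).trans_lt hk
    obtain ⟨s, hs, hs1⟩ : ∃ s : ℝ, 1 < s ∧ s ^ 2 * ‖inner y y‖ ≤ 1 := by
      have h2 : ∀ᶠ s : ℝ in 𝓝[>] 1, s ^ 2 * ‖inner y y‖ < 1 := by
        refine Filter.Tendsto.eventually_lt_const (v := 1 ^ 2 * ‖inner y y‖) (by simpa using h1) ?_
        exact tendsto_nhdsWithin_of_tendsto_nhds (Continuous.tendsto (by fun_prop) 1)
      obtain ⟨s, hs, hs1⟩ := (h2.and self_mem_nhdsWithin).exists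
      exact ⟨s, hs1, hs.le⟩
    have h3 := hφ (s • y) (by rw [unitBall, Set.mem_ofPred_eq, norm_inner_real_smul]; exact hs1)
    rw [hre] at h3
    nlinarith
  obtain ⟨g, u, hgu, huC⟩ := RCLike.geometric_hahn_banach_open (𝕜 := ℂ) (convex_ball (0 : 𝒜) 1)
    Metric.isOpen_ball hC hdisj
  change ∀ a ∈ _, (g a).re < u at hgu
  change ∀ a ∈ _, u ≤ (g a).re at huC
  have hu : 0 < u := by simpa using hgu 0 (Metric.mem_ball_self one_pos)
  have hgr : ∀ (r : ℝ) a, (g (r • a)).re = r * (g a).re := fun r a => by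
    rw [← Complex.coe_smul, map_smul, smul_eq_mul, Complex.re_ofReal_mul]
  have hgpos : ∀ a, 0 ≤ a → 0 ≤ (g a).re := fun a ha => by
    by_contra! h
    -- `C` is stable under adding positive elements. If `Re g a < 0`, this multiple of `a` would
    -- bring `Re g` down to `u - 1`, below its lower bound `u` on `C`.
    have h1 := huC (inner x x + (((g (inner x x)).re - u + 1) / -(g a).re) • a) ⟨x, hx, ?_⟩
    · rw [map_add, Complex.add_re, hgr] at h1
      have h2 : ((g (inner x x)).re - u + 1) / -(g a).re * (g a).re =
          -((g (inner x x)).re - u + 1) := by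
        rw [div_neg, neg_mul, div_mul_cancel₀ _ h.ne]
      linarith
    · have h3 := huC _ ⟨x, hx, le_rfl⟩
      exact le_add_of_nonneg_right (smul_nonneg (div_nonneg (by linarith) (by linarith)) ha)
  have hgle : ∀ a, (g a).re ≤ u * ‖a‖ := fun a => by
    by_contra! h
    have h0 : 0 < (g a).re := lt_of_le_of_lt (by positivity) h
    have h1 := hgu ((u / (g a).re) • a) (by
      rw [mem_ball_zero_iff, norm_smul, Real.norm_of_nonneg (by positivity), div_mul_eq_mul_div,
        div_lt_one h0]
      exact h)
    rw [hgr, div_mul_cancel₀ _ h0.ne'] at h1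
    exact lt_irrefl _ h1
  -- The hermitian part of `g`, divided by `u`: it agrees with `u⁻¹ Re g` on positive elements and
  -- is real there.
  let ψ : 𝒜 →L[ℂ] ℂ :=
    { toFun := fun a => ((2 * u : ℝ) : ℂ)⁻¹ * (g a + star (g (star a)))
      map_add' := fun a b => by simp only [star_add, map_add]; ring
      map_smul' := fun c a => by
        simp only [star_smul, map_smul, smul_eq_mul, star_mul', star_star, RingHom.id_apply]
        ring
      cont := by fun_prop }
  have hψ : ∀ a, 0 ≤ a → ψ a = ((u⁻¹ * (g a).re : ℝ) : ℂ) := fun a ha => by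
    change ((2 * u : ℝ) : ℂ)⁻¹ * (g a + star (g (star a))) = _
    rw [(IsSelfAdjoint.of_nonneg ha).star_eq, Complex.star_def, Complex.add_conj]
    push_cast
    field_simp
  refine ⟨ψ, fun a ha => ?_, fun a ha => ?_, fun y hy => ?_⟩
  · rw [hψ a ha, Complex.zero_le_real]
    exact mul_nonneg (by positivity) (hgpos a ha)
  · rw [hψ a ha, Complex.norm_real, Real.norm_of_nonneg (mul_nonneg (by positivity) (hgpos a ha)),
      inv_mul_le_iff₀ hu]
    exact hgle a
  · rw [hψ _ (inner_self_nonneg y), Complex.ofReal_re, le_inv_mul_iff₀ hu, mul_one]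
    exact huC _ ⟨y, hy, le_rfl⟩

/-- The semi-inner product `f ⟨x, y⟩` on `ℓ₂(𝒜)` given by a positive functional `f`. -/
@[reducible]
noncomputable def functionalCore {f : 𝒜 →L[ℂ] ℂ} (hf : IsPositiveFunctional f) :
    PreInnerProductSpace.Core ℂ (l2 𝒜) where
  inner x y := f (inner x y)
  conj_inner_symm x y := by
    rw [← star_inner x y, hf.map_star]; exact star_star _
  re_inner_nonneg x := (Complex.nonneg_iff.1 (hf _ (inner_self_nonneg x))).1
  add_left x y z := by rw [inner_add_left, map_add]
  smul_left x y r := by rw [inner_smul_left, map_smul]; rfl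

/-- For a pure state, the unit ball of `ℓ₂(𝒜)` is dense in the unit ball of the induced
seminorm. -/
theorem exists_mem_unitBall_of_pure {f : 𝒜 →L[ℂ] ℂ} (hf : IsPureState f) (x : l2 𝒜)
    (hx : (f (inner x x)).re ≤ 1) {ε : ℝ} (hε : 0 < ε) :
    ∃ k ∈ unitBall 𝒜, (f (inner (x - k) (x - k))).re < ε := by
  by_contra! hcon
  obtain ⟨φ, C, hφ, hφx, hφC⟩ := (functionalCore hf.pos).exists_separating convex_unitBall
    zero_mem_unitBall hε hcon
  obtain ⟨ψ, hψ, hψ1, hψφ⟩ := exists_dominating_functional φ hφ hφx.le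
  obtain ⟨b, hb⟩ := CStarAlgebra.nonneg_iff_eq_star_mul_self.1 (inner_self_nonneg x)
  set η := (φ x).re - 1 with hη
  have hη0 : 0 < η := by linarith
  -- The square term in `ε` keeps `|φ(x - xa)| ≤ η/2`, with `|C| + 1` avoiding a zero denominator.
  -- The term `η/2` gives `ψ ⟨xa, xa⟩ < 1 + η/2`, against the lower bound `(1 + η/2)²`.
  obtain ⟨a, ha1, ha2⟩ := hf.exists_approx hψ hψ1 b (ε := min (η / 2) ((η / (2 * (|C| + 1))) ^ 2))
    (by positivity)
  have e1 : inner (x - mulRight x a) (x - mulRight x a) = star (b - b * a) * (b - b * a) := by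
    simp only [inner_sub_left, inner_sub_right, inner_mulRight_left, inner_mulRight_right, hb,
      star_sub, star_mul, sub_mul, mul_sub, mul_assoc]
  have e2 : inner (mulRight x a) (mulRight x a) = star (b * a) * (b * a) := by
    simp only [inner_mulRight_left, inner_mulRight_right, hb, star_mul, mul_assoc]
  rw [← e1] at ha1
  rw [← e2, ← hb] at ha2
  have h1 : ‖φ (x - mulRight x a)‖ ≤ η / 2 := by
    have h2 : √(f (inner (x - mulRight x a) (x - mulRight x a))).re ≤ η / (2 * (|C| + 1)) := by
      rw [Real.sqrt_le_left (by positivity)]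
      exact ha1.le.trans (min_le_right _ _)
    calc _ ≤ C * _ := hφC _
      _ ≤ (|C| + 1) * (η / (2 * (|C| + 1))) :=
        mul_le_mul ((le_abs_self C).trans (by linarith)) h2 (Real.sqrt_nonneg _) (by positivity)
      _ = η / 2 := by field_simp
  have h2 : 1 + η / 2 ≤ (φ (mulRight x a)).re := by
    have h3 := (Complex.re_le_norm _).trans h1
    rw [map_sub, Complex.sub_re] at h3
    linarith
  have h4 := hψφ ((1 + η / 2)⁻¹ • mulRight x a) (by
    rw [real_smul_eq, map_smul, smul_eq_mul, Complex.re_ofReal_mul, le_inv_mul_iff₀ (by positivity)]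
    linarith)
  have h5 : (ψ (inner ((1 + η / 2)⁻¹ • mulRight x a) ((1 + η / 2)⁻¹ • mulRight x a))).re =
      (1 + η / 2)⁻¹ ^ 2 * (ψ (inner (mulRight x a) (mulRight x a))).re := by
    rw [real_smul_eq, inner_smul_left, inner_smul_right, Complex.star_def, Complex.conj_ofReal,
      map_smul, map_smul, smul_eq_mul, smul_eq_mul, Complex.re_ofReal_mul, Complex.re_ofReal_mul]
    ring
  rw [h5, inv_pow, le_inv_mul_iff₀ (by positivity)] at h4
  have h6 := min_le_left (η / 2) ((η / (2 * (|C| + 1))) ^ 2)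
  nlinarith

end l2

/-! ### The range inclusion -/

theorem theorem2 {𝒜 : Type*} [NonUnitalCStarAlgebra 𝒜] [PartialOrder 𝒜] [StarOrderedRing 𝒜]
    (A B : Adjointable 𝒜) (lam : ℝ) (hle : B * star B ≤ lam • (A * star A))
    (f : 𝒜 →L[ℂ] ℂ) (hf : IsPureState f) :
    Set.range B ⊆ Set.range A + nullSet f := by
  rintro _ ⟨z, rfl⟩
  let c := l2.functionalCore hf.pos
  have hc : ∀ x y, c.inner x y = f (l2.inner x y) := fun _ _ => rfl
  let φ : l2 𝒜 →ₗ[ℂ] ℂ :=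
    { toFun := fun w => f (l2.inner (B.toLin z) w)
      map_add' := fun x y => by rw [l2.inner_add_right, map_add]
      map_smul' := fun r x => by rw [l2.inner_smul_right, map_smul, RingHom.id_apply] }
  have hBA : ∀ w, (f (l2.inner (B.adj w) (B.adj w))).re ≤
      lam * (f (l2.inner (A.adj w) (A.adj w))).re := fun w => by
    have h1 : l2.inner (B.toLin (B.adj w)) w ≤ l2.inner ((lam : ℂ) • A.toLin (A.adj w)) w := hle w
    rw [l2.inner_smul_left, Complex.star_def, Complex.conj_ofReal, B.inner_adj, A.inner_adj] at h1
    have h2 := hf.pos _ (sub_nonneg.2 h1)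
    rw [map_sub, sub_nonneg, map_smul, smul_eq_mul] at h2
    simpa [Complex.re_ofReal_mul] using (Complex.le_def.1 h2).1
  -- `|lam|` replaces `lam`, whose sign is not assumed.
  have hφ : ∀ w, ‖φ w‖ ≤ √(f (l2.inner z z)).re * √|lam| *
      √(c.inner (A.adj w) (A.adj w)).re := fun w => by
    have h1 : ‖f (l2.inner z (B.adj w))‖ ≤ √(f (l2.inner z z)).re *
        √(f (l2.inner (B.adj w) (B.adj w))).re :=
      InnerProductSpace.Core.norm_inner_le_norm (c := c) z (B.adj w)
    rw [← B.inner_adj] at h1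
    refine h1.trans ?_
    rw [mul_assoc, ← Real.sqrt_mul (abs_nonneg _)]
    refine mul_le_mul_of_nonneg_left (Real.sqrt_le_sqrt ((hBA w).trans ?_)) (Real.sqrt_nonneg _)
    exact mul_le_mul_of_nonneg_right (le_abs_self _) (c.re_inner_nonneg _)
  obtain ⟨x, hx⟩ := c.exists_inner_eq (K := l2.unitBall 𝒜)
    (fun x hx ε hε => l2.exists_mem_unitBall_of_pure hf x hx hε)
    (fun k hk => by
      obtain ⟨v, hv⟩ := l2.exists_tendsto_sum k hk
      refine ⟨v, ?_⟩
      have := (Complex.continuous_re.comp f.continuous).tendsto 0 |>.comp hv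
      simpa using! this) A.adj φ _ hφ
  refine ⟨A.toLin x, ⟨x, rfl⟩, B.toLin z - A.toLin x, ?_, add_sub_cancel _ _⟩
  change f (l2.inner (B.toLin z - A.toLin x) (B.toLin z - A.toLin x)) = 0
  rw [l2.inner_sub_left, map_sub, A.inner_adj]
  -- The Riesz identity is used at `w = Bz - Ax` itself.
  exact sub_eq_zero.2 (hx _).symm
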